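/- All rings are associative with identity. A ring $R$ with center $C$ is called *centrally essential* if the module $R_C$ is an essential extension of the module $C_C$, i.e. every nonzero $C$-submodule of $R$ contains a nonzero element of $C$. A ring is *semiprime* if it has no nonzero two-sided ideal $I$ with $I^2=0$. Let $A$ be a nonzero semiprime ring whose additive group is torsion-free, and let $G$ be an arbitrary group. Then the group ring $AG$ is centrally essential if and only if the ring $A$ and the group $G$ are both commutative. -/

import Mathlib

/-- A ring `R` with center `C` is *centrally essential* if `R`, as a module over `C`, is an
essential extension of `C`: every nonzero `C`-submodule of `R` contains a nonzero element of `C`.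
The scalar action is `c • r = c * r`, which equals `r * c` because `c` is central, so the left and
the right `C`-module structures on `R` coincide. -/
def IsCentrallyEssential (R : Type*) [Ring R] : Prop :=
  ∀ N : Submodule (Subring.center R) R, N ≠ ⊥ → ∃ x ∈ N, x ∈ Subring.center R ∧ x ≠ 0

/-- A ring `R` is *semiprime* if it has no nonzero two-sided ideal `I` with `I ^ 2 = 0`, that is,
whose elements all have pairwise product `0`
(equivalently, it has no nonzero nilpotent two-sided ideal). -/
def IsSemiprimeRing (R : Type*) [Ring R] : Prop :=
  ∀ I : TwoSidedIdeal R, (∀ x ∈ I, ∀ y ∈ I, x * y = 0) → I = ⊥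

/-! A centrally essential ring whose center has no nonzero square-zero element is commutative, so it
suffices to rule out such elements in the center of `AG`. The coefficients of a central `x` generate
a commutative, reduced, torsion-free ring of finite type. The Nullstellensatz gives it a complex
point not killing a chosen nonzero coefficient, which reduces the claim to `ℂG`; there positivity of
the trace of `x * conjInv x` settles it. -/

/-- A centrally essential ring with no nonzero central element of square zero is commutative. -/
theorem IsCentrallyEssential.mul_comm_of_central_sq {R : Type*} [Ring R]
    (h : IsCentrallyEssential R) (hred : ∀ z ∈ Subring.center R, z * z = 0 → z = 0) (a b : R) :
    a * b = b * a := by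
  have key : ∀ r : R, r ≠ 0 → ∃ c ∈ Subring.center R, c * r ∈ Subring.center R ∧ c * r ≠ 0 := by
    intro r hr
    obtain ⟨x, hx, hxc, hx0⟩ := h (Submodule.span (Subring.center R) {r})
      (by simpa [Submodule.span_singleton_eq_bot] using hr)
    obtain ⟨c, rfl⟩ := Submodule.mem_span_singleton.1 hx
    exact ⟨c, c.2, hxc, hx0⟩
  by_contra hab
  obtain ⟨c, hc, hz, hz0⟩ := key (a * b - b * a) (sub_ne_zero.2 hab)
  -- For such `d`, `d(ab - ba) = (da)b - b(da) = 0`. Taking `d = z`, or `dz` in place of `d`,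
  -- produces central elements of square zero.
  have hann : ∀ d ∈ Subring.center R, d * a ∈ Subring.center R → d * (c * (a * b - b * a)) = 0 := by
    intro d hd hda
    have h1 : d * (a * b - b * a) = 0 := by
      have h2 := (Subring.mem_center_iff.1 hda) b
      have h3 := (Subring.mem_center_iff.1 hd) b
      rw [mul_sub, ← mul_assoc, ← mul_assoc, ← h2, ← h3, mul_assoc, sub_self]
    rw [← mul_assoc, ← (Subring.mem_center_iff.1 hd) c, mul_assoc, h1, mul_zero]
  generalize c * (a * b - b * a) = z at hz hz0 hann
  by_cases hza : z * a = 0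
  · exact hz0 (hred z hz (hann z hz (hza ▸ Subring.zero_mem _)))
  · obtain ⟨d, hd, hdc, hd0⟩ := key _ hza
    have hdz : d * z ∈ Subring.center R := Subring.mul_mem _ hd hz
    have h1 := hann (d * z) hdz (by rwa [mul_assoc])
    have h2 : d * z = 0 := hred _ hdz (by
      rw [← (Subring.mem_center_iff.1 hdz), mul_assoc, ← (Subring.mem_center_iff.1 hz) (d * z), h1, mul_zero])
    exact hd0 (by rw [← mul_assoc, h2, zero_mul])

/-- A semiprime ring has no nonzero central element of square zero. -/
theorem IsSemiprimeRing.eq_zero_of_mem_center {A : Type*} [Ring A] (hA : IsSemiprimeRing A) {c : A}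
    (hc : c ∈ Subring.center A) (h : c * c = 0) : c = 0 := by
  have hc' := Subring.mem_center_iff.1 hc
  let I : TwoSidedIdeal A := TwoSidedIdeal.mk' {x | ∃ a, x = c * a} ⟨0, by simp⟩
    (by rintro _ _ ⟨a, rfl⟩ ⟨b, rfl⟩; exact ⟨a + b, (mul_add _ _ _).symm⟩)
    (by rintro _ ⟨a, rfl⟩; exact ⟨-a, (mul_neg _ _).symm⟩)
    (by rintro x _ ⟨a, rfl⟩; exact ⟨x * a, by rw [← mul_assoc, hc', mul_assoc]⟩)
    (by rintro _ x ⟨a, rfl⟩; exact ⟨a * x, mul_assoc _ _ _⟩)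
  have hI : ∀ x, x ∈ I ↔ ∃ a, x = c * a := fun x => TwoSidedIdeal.mem_mk' _ _ _ _ _ _ x
  have hbot : I = ⊥ := hA I (by
    intro x hx y hy
    obtain ⟨a, rfl⟩ := (hI x).1 hx
    obtain ⟨b, rfl⟩ := (hI y).1 hy
    rw [mul_assoc, ← mul_assoc a, hc' a, mul_assoc c a, ← mul_assoc, h, zero_mul])
  have : c ∈ I := (hI c).2 ⟨1, (mul_one c).symm⟩
  rwa [hbot, TwoSidedIdeal.mem_bot] at this

/-- A nontrivial finitely generated commutative `ℚ`-algebra has a complex point. -/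
theorem nonempty_algHom_complex_of_finiteType (T : Type*) [CommRing T] [Nontrivial T] [Algebra ℚ T]
    [Algebra.FiniteType ℚ T] : Nonempty (T →ₐ[ℚ] ℂ) := by
  obtain ⟨m, hm⟩ := Ideal.exists_maximal T
  let := Ideal.Quotient.field m
  have : Module.Finite ℚ (T ⧸ m) := finite_of_finite_type_of_isJacobsonRing _ _
  exact ⟨(IsAlgClosed.lift : T ⧸ m →ₐ[ℚ] ℂ).comp (Ideal.Quotient.mkₐ ℚ m)⟩

/-- A finitely generated commutative ring has a complex point at which a given element does not
vanish, provided that no nonzero integer multiple of a power of this element is zero. -/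
theorem exists_ringHom_complex_ne_zero {K : Type*} [CommRing K] {s : Set K} (hs : s.Finite)
    (hgen : Algebra.adjoin ℤ s = ⊤) (r : K) (hr : ∀ n k : ℕ, n ≠ 0 → (n : K) * r ^ k ≠ 0) :
    ∃ φ : K →+* ℂ, φ r ≠ 0 := by
  -- A prime avoiding `M` has a quotient of characteristic zero in which `r` survives.
  let M : Submonoid K := (nonZeroDivisors ℕ).map (Nat.castRingHom K) ⊔ Submonoid.powers r
  have hM : Disjoint ((⊥ : Ideal K) : Set K) (M : Set K) := by
    rw [Set.disjoint_left]
    rintro x hx hxM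
    obtain ⟨_, ⟨n, hn, rfl⟩, _, ⟨k, rfl⟩, rfl⟩ := Submonoid.mem_sup.1 hxM
    exact hr n k (nonZeroDivisors.ne_zero hn) (by simpa using hx)
  obtain ⟨P, hP, -, hPM⟩ := Ideal.exists_le_prime_disjoint _ M hM
  rw [Set.disjoint_right] at hPM
  have hrP : r ∉ P := hPM (Submonoid.mem_sup_right (Submonoid.mem_powers r))
  have : CharZero (K ⧸ P) := charZero_of_inj_zero fun n hn => by
    by_contra h0
    rw [← map_natCast (Ideal.Quotient.mk P), Ideal.Quotient.eq_zero_iff_mem] at hn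
    exact hPM (Submonoid.mem_sup_left ⟨n, mem_nonZeroDivisors_of_ne_zero h0, rfl⟩) hn
  let F := FractionRing (K ⧸ P)
  have : CharZero F := charZero_of_injective_algebraMap (IsFractionRing.injective (K ⧸ P) F)
  let ι : K →+* F := (algebraMap (K ⧸ P) F).comp (Ideal.Quotient.mk P)
  have hιr : ι r ≠ 0 := by
    intro h
    rw [RingHom.comp_apply, IsFractionRing.to_map_eq_zero_iff, Ideal.Quotient.eq_zero_iff_mem] at h
    exact hrP h
  -- Adjoining the inverse makes `r` a unit, so no complex point of `T` can kill it.
  let T : Subalgebra ℚ F := Algebra.adjoin ℚ (insert (ι r)⁻¹ (ι '' s))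
  have hι : ∀ x, ι x ∈ T := by
    intro x
    have hx : x ∈ Algebra.adjoin ℤ s := hgen ▸ Algebra.mem_top
    induction hx using Algebra.adjoin_induction with
    | mem x hx => exact Algebra.subset_adjoin (Or.inr ⟨x, hx, rfl⟩)
    | algebraMap n => simp
    | add x y _ _ hx hy => rw [map_add]; exact add_mem hx hy
    | mul x y _ _ hx hy => rw [map_mul]; exact mul_mem hx hy
  have hfin : Algebra.FiniteType ℚ T := (Subalgebra.fg_iff_finiteType _).1
    (Subalgebra.fg_def.2 ⟨_, (hs.image ι).insert _, rfl⟩)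
  obtain ⟨ψ⟩ := nonempty_algHom_complex_of_finiteType T
  let κ : K →+* T := ι.codRestrict T hι
  refine ⟨(ψ : T →+* ℂ).comp κ, ?_⟩
  have hu : κ r * ⟨(ι r)⁻¹, Algebra.subset_adjoin (Or.inl rfl)⟩ = 1 :=
    Subtype.ext (mul_inv_cancel₀ hιr)
  exact ((IsUnit.of_mul_eq_one _ hu).map ψ).ne_zero

namespace MonoidAlgebra

/-- The conjugate-linear anti-automorphism of a complex group algebra that inverts group
elements. -/
noncomputable def conjInv {G : Type*} [Group G] (x : MonoidAlgebra ℂ G) : MonoidAlgebra ℂ G :=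
  mapDomain (·⁻¹) (map (starRingEnd ℂ : ℂ →+ ℂ) x)

section conjInv

variable {G : Type*} [Group G]

theorem conjInv_zero : conjInv (0 : MonoidAlgebra ℂ G) = 0 := by
  simp [conjInv, mapDomain_zero, MonoidAlgebra.map_zero]

theorem conjInv_add (x y : MonoidAlgebra ℂ G) : conjInv (x + y) = conjInv x + conjInv y := by
  simp [conjInv, mapDomain_add, MonoidAlgebra.map_add]

theorem conjInv_single (g : G) (a : ℂ) :
    conjInv (single g a) = single g⁻¹ (starRingEnd ℂ a) := by
  simp [conjInv, mapDomain_single, map_single]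

theorem conjInv_mul (x y : MonoidAlgebra ℂ G) : conjInv (x * y) = conjInv y * conjInv x := by
  induction x using induction_linear with
  | zero => simp [conjInv_zero]
  | add x x' hx hx' => rw [add_mul, conjInv_add, hx, hx', conjInv_add, mul_add]
  | single g a =>
    induction y using induction_linear with
    | zero => simp [conjInv_zero]
    | add y y' hy hy' => rw [mul_add, conjInv_add, hy, hy', conjInv_add, add_mul]
    | single h b => simp [conjInv_single, single_mul_single, mul_comm]

theorem conjInv_conjInv (x : MonoidAlgebra ℂ G) : conjInv (conjInv x) = x := by
  induction x using induction_linear with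
  | zero => simp [conjInv_zero]
  | add x y hx hy => rw [conjInv_add, conjInv_add, hx, hy]
  | single g a => simp [conjInv_single]

theorem coeff_conjInv_inv (x : MonoidAlgebra ℂ G) (g : G) :
    (conjInv x).coeff g⁻¹ = starRingEnd ℂ (x.coeff g) := by
  simp only [conjInv, mapDomain]
  rw [coeff_ofCoeff, Finsupp.mapDomain_apply inv_injective]
  rfl

theorem coeff_mul_conjInv_one (x : MonoidAlgebra ℂ G) :
    (x * conjInv x).coeff 1 = ((x.coeff.sum fun _ a => ‖a‖ ^ 2 : ℝ) : ℂ) := by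
  have h : ∀ y : MonoidAlgebra ℂ G, (x * y).coeff 1 = x.coeff.sum fun g a => a * y.coeff g⁻¹ := by
    intro y
    induction x using induction_linear with
    | zero => simp
    | add x x' hx hx' =>
      rw [add_mul, coeff_add, Finsupp.add_apply, hx, hx', coeff_add,
        Finsupp.sum_add_index'] <;> simp [add_mul]
    | single g a => simp
  rw [h, Finsupp.sum, Finsupp.sum, Complex.ofReal_sum]
  refine Finset.sum_congr rfl fun g _ => ?_
  rw [coeff_conjInv_inv, Complex.mul_conj']
  simp

theorem eq_zero_of_mul_conjInv {x : MonoidAlgebra ℂ G} (h : x * conjInv x = 0) : x = 0 := by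
  have h1 := coeff_mul_conjInv_one x
  rw [h, coeff_zero, Finsupp.zero_apply, eq_comm, Complex.ofReal_eq_zero, Finsupp.sum,
    Finset.sum_eq_zero_iff_of_nonneg fun _ _ => by positivity] at h1
  ext g
  by_contra hg
  exact hg (by simpa using h1 g (Finsupp.mem_support_iff.2 hg))

/-- An element of a complex group algebra of square zero that commutes with the group is zero. -/
theorem eq_zero_of_mul_self_of_commute {x : MonoidAlgebra ℂ G}
    (hc : ∀ g, x * single g 1 = single g 1 * x) (h : x * x = 0) : x = 0 := by
  have hcomm : ∀ y, x * y = y * x := by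
    intro y
    induction y using induction_linear with
    | zero => simp
    | add y y' hy hy' => rw [mul_add, add_mul, hy, hy']
    | single g a =>
      have : (single g a : MonoidAlgebra ℂ G) = a • single g 1 := by simp
      rw [this, mul_smul_comm, hc, smul_mul_assoc]
  -- Used for `x`, then for the self-adjoint `x * conjInv x`, whose square contains the factor `x *
  -- x` because `x` is central.
  apply eq_zero_of_mul_conjInv
  apply eq_zero_of_mul_conjInv
  rw [conjInv_mul, conjInv_conjInv, mul_assoc, hcomm, mul_assoc, mul_assoc, ← hcomm (conjInv x),
    ← mul_assoc x x, h, zero_mul, mul_zero]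

end conjInv

variable {A G : Type*} [Ring A] [Group G]

theorem coeff_mem_center {x : MonoidAlgebra A G} (hx : x ∈ Subring.center (MonoidAlgebra A G))
    (g : G) : x.coeff g ∈ Subring.center A := by
  refine Subring.mem_center_iff.2 fun a => ?_
  have h := congrArg (fun y => y.coeff g) (Subring.mem_center_iff.1 hx (single 1 a))
  simpa using h

/-- The centre of the group ring of a semiprime ring with torsion-free additive group has no nonzero
element of square zero. -/
theorem eq_zero_of_mem_center_of_mul_self (hA : IsSemiprimeRing A) (htf : IsAddTorsionFree A)
    {x : MonoidAlgebra A G} (hx : x ∈ Subring.center (MonoidAlgebra A G)) (h : x * x = 0) :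
    x = 0 := by
  by_contra hx0
  obtain ⟨g, hg⟩ : ∃ g, x.coeff g ≠ 0 := by
    by_contra! hall
    exact hx0 (by ext g; exact hall g)
  let coef : G → Subring.center A := fun g => ⟨x.coeff g, coeff_mem_center hx g⟩
  let s : Set (Subring.center A) := Set.range coef
  have hs : s.Finite := by
    have : (Subtype.val '' s).Finite := by
      rw [← Set.range_comp]
      exact (Finsupp.finite_range x.coeff :)
    exact this.of_finite_image Subtype.val_injective.injOn
  let S := Algebra.adjoin ℤ s
  let r : S := ⟨coef g, Algebra.subset_adjoin ⟨g, rfl⟩⟩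
  let f : S →+* A := (Subring.center A).subtype.comp S.val.toRingHom
  have hf : Function.Injective f := Subtype.val_injective.comp Subtype.val_injective
  have hr : ∀ n k : ℕ, n ≠ 0 → (n : S) * r ^ k ≠ 0 := by
    intro n k hn h0
    -- Torsion-freeness removes `n`; reducedness of the center, from semiprimeness, then removes the
    -- exponent.
    have hpow : f r ^ k = 0 := by
      have h1 := congrArg f h0
      rw [map_mul, map_natCast, map_zero, map_pow, ← nsmul_eq_mul] at h1
      exact (smul_eq_zero_iff_right hn).1 h1
    have : IsReduced (Subring.center A) := isReduced_iff_pow_one_lt 2 (by norm_num) |>.2 fun c hc =>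
      Subtype.ext (hA.eq_zero_of_mem_center c.2 (by simpa [pow_two] using congrArg Subtype.val hc))
    have : coef g = 0 := eq_zero_of_pow_eq_zero (n := k) (Subtype.ext hpow)
    exact hg (congrArg Subtype.val this)
  obtain ⟨φ, hφ⟩ := exists_ringHom_complex_ne_zero (K := S) (s := Subtype.val ⁻¹' s)
    (hs.preimage Subtype.val_injective.injOn) (Algebra.adjoin_adjoin_coe_preimage) r hr
  obtain ⟨y, hy⟩ : x ∈ Set.range (map (M := G) (f : S →+ A)) := by
    rw [range_map]
    exact fun i => ⟨⟨coef i, Algebra.subset_adjoin ⟨i, rfl⟩⟩, rfl⟩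
  have hinj : Function.Injective (mapRingHom G f) := map_injective _ hf
  have hy' : mapRingHom G f y = x := hy
  have hyy : y * y = 0 := hinj (by rw [map_mul, hy', h, map_zero])
  have hyc : ∀ g, y * single g 1 = single g 1 * y := fun g => hinj (by
    rw [map_mul, map_mul, hy']; exact (Subring.mem_center_iff.1 hx _).symm)
  have hz : mapRingHom G φ y = 0 := eq_zero_of_mul_self_of_commute
    (fun g => by simpa using congrArg (mapRingHom G φ) (hyc g))
    (by rw [← map_mul, hyy, map_zero])
  have hyg : y.coeff g = r := hf (by
    rw [← coeff_mapRingHom, hy']; rfl)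
  exact hφ (by rw [← hyg, ← coeff_mapRingHom, hz]; rfl)

end MonoidAlgebra

theorem proposition3p4 {A : Type*} {G : Type*} [Ring A] [Nontrivial A] [Group G]
    (hA : IsSemiprimeRing A) (htf : IsAddTorsionFree A) :
    IsCentrallyEssential (MonoidAlgebra A G) ↔
      (∀ a b : A, a * b = b * a) ∧ (∀ g h : G, g * h = h * g) := by
  constructor
  · intro h
    have hcomm := h.mul_comm_of_central_sq fun z hz hzz =>
      MonoidAlgebra.eq_zero_of_mem_center_of_mul_self hA htf hz hzz
    refine ⟨fun a b => ?_, fun g k => ?_⟩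
    · have := hcomm (.single 1 a) (.single 1 b)
      simpa [MonoidAlgebra.single_mul_single] using this
    · have := hcomm (.single g 1) (.single k 1)
      simpa [MonoidAlgebra.single_mul_single, MonoidAlgebra.single_left_inj] using this
  · rintro ⟨hAc, hGc⟩ N hN
    obtain ⟨x, hx, hx0⟩ := N.exists_mem_ne_zero_of_ne_bot hN
    -- `AG` is commutative here, so any nonzero element of `N` works.
    refine ⟨x, hx, Subring.mem_center_iff.2 fun y => ?_, hx0⟩
    let : CommRing A := { (inferInstance : Ring A) with mul_comm := hAc }
    let : CommGroup G := { (inferInstance : Group G) with mul_comm := hGc }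
    exact mul_comm (G := MonoidAlgebra A G) y x
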